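/- Let $d$ be a natural number and let $A, P \in \mathrm{GL}(d,\mathbb{R})$. Let $G = \mathbb{R}^d \rtimes \langle A \rangle$ be the semidirect product of $\mathbb{R}^d$ and the cyclic group $\langle A\rangle = \{A^j : j \in \mathbb{Z}\}$, with group law $(x, A^j)(y, A^k) = (x + A^j y, A^{j+k})$ and with the product of the usual topology on $\mathbb{R}^d$ and the discrete topology on $\langle A \rangle$. Let $\pi$ be the unitary representation of $G$ on $L^2(\mathbb{R}^d)$ given by $$\pi(x, A^j) f(t) = |\det A|^{-j/2} f\big(A^{-j}(t - x)\big), \qquad t \in \mathbb{R}^d .$$ A set $\Lambda \subseteq G$ is called separated if there is a nonempty open set $U \subseteq G$ with $\#(\Lambda \cap gU) \le 1$ for all $g \in G$, and relatively separated if it is a finite union of separated sets. Let $\mathcal{B}_\pi$ be the set of all $\psi \in L^2(\mathbb{R}^d)$ such that, for every relatively separated $\Lambda \subseteq G$, the family $\{\pi(\lambda)\psi\}_{\lambda \in \Lambda}$ is a Bessel sequence, that is, there is a constant $C_\Lambda < \infty$ with $\sum_{\lambda \in \Lambda} |\langle f, \pi(\lambda)\psi\rangle|^2 \le C_\Lambda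 \|f\|^2$ for all $f \in L^2(\mathbb{R}^d)$. If there exists $\psi \in \mathcal{B}_\pi$ such that the family $\{\pi(A^j P k, A^j)\psi\}_{j \in \mathbb{Z},\, k \in \mathbb{Z}^d}$ is a Parseval frame for $L^2(\mathbb{R}^d)$, that is, $$\sum_{j \in \mathbb{Z}} \sum_{k \in \mathbb{Z}^d} |\langle f, \pi(A^j P k, A^j)\psi\rangle|^2 = \|f\|^2 \qquad \text{for all } f \in L^2(\mathbb{R}^d),$$ then $|\det A| \ne 1$. -/

import Mathlib

open MeasureTheory
open scoped Pointwise Matrix MatrixGroups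

noncomputable section

/-- The Hilbert space `L²(ℝᵈ)` of complex-valued functions, with respect to Lebesgue measure. -/
abbrev L2 (d : ℕ) : Type := Lp ℂ 2 (volume : Measure (Fin d → ℝ))

/-- `{v i}` is a Bessel family: `∑ |⟨f, v i⟩|² ≤ C ‖f‖²` for all `f`, with a finite constant `C`. -/
def IsBesselFamily {H ι : Type*} [NormedAddCommGroup H] [InnerProductSpace ℂ H]
    (v : ι → H) : Prop :=
  ∃ C : ℝ, ∀ f : H, Summable (fun i => ‖inner ℂ (v i) f‖ ^ 2) ∧
    ∑' i, ‖inner ℂ (v i) f‖ ^ 2 ≤ C * ‖f‖ ^ 2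

/-- `{v i}` is a Parseval frame: `∑ |⟨f, v i⟩|² = ‖f‖²` for all `f`. -/
def IsParsevalFrame {H ι : Type*} [NormedAddCommGroup H] [InnerProductSpace ℂ H]
    (v : ι → H) : Prop :=
  ∀ f : H, HasSum (fun i => ‖inner ℂ (v i) f‖ ^ 2) (‖f‖ ^ 2)

/-- A subset of a topological group is separated if, for some nonempty open set `U`, it meets
every left translate of `U` in at most one point. -/
def IsSeparatedSet {G : Type*} [Group G] [TopologicalSpace G] (Λ : Set G) : Prop :=
  ∃ U : Set G, IsOpen U ∧ U.Nonempty ∧ ∀ g : G, (Λ ∩ g • U).Subsingleton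

/-- A subset of a topological group is relatively separated if it is a finite union of
separated sets. -/
def IsRelativelySeparated {G : Type*} [Group G] [TopologicalSpace G] (Λ : Set G) : Prop :=
  ∃ S : Set (Set G), S.Finite ∧ (∀ Γ ∈ S, IsSeparatedSet Γ) ∧ Λ = ⋃₀ S

variable {d : ℕ}

/-- The action of the cyclic group `⟨A⟩ = {Aʲ : j ∈ ℤ}` on `ℝᵈ` by matrix multiplication. -/
def dilationAction (A : GL (Fin d) ℝ) :
    Subgroup.zpowers A →* MulAut (Multiplicative (Fin d → ℝ)) where
  toFun M :=
    { toFun := fun x => .ofAdd ((M.1 : Matrix (Fin d) (Fin d) ℝ) *ᵥ x.toAdd)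
      invFun := fun x => .ofAdd (((M.1⁻¹ : GL (Fin d) ℝ) : Matrix (Fin d) (Fin d) ℝ) *ᵥ x.toAdd)
      left_inv := fun x => by simp
      right_inv := fun x => by simp
      map_mul' := fun x y => by simp [Matrix.mulVec_add] }
  map_one' := by ext x; simp
  map_mul' M N := by ext x; simp [Matrix.mulVec_mulVec]

/-- The group `G = ℝᵈ ⋊ ⟨A⟩`, with `(x, Aʲ) (y, Aᵏ) = (x + Aʲ y, Aʲ⁺ᵏ)`. -/
def WaveletGroup (A : GL (Fin d) ℝ) : Type :=
  Multiplicative (Fin d → ℝ) ⋊[dilationAction A] Subgroup.zpowers A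

namespace WaveletGroup

variable {A : GL (Fin d) ℝ}

instance : Group (WaveletGroup A) :=
  inferInstanceAs (Group (Multiplicative (Fin d → ℝ) ⋊[dilationAction A] Subgroup.zpowers A))

/-- The element `(x, M)` of `ℝᵈ ⋊ ⟨A⟩`. -/
def mk (x : Fin d → ℝ) (M : Subgroup.zpowers A) : WaveletGroup A :=
  ⟨.ofAdd x, M⟩

/-- The translation part `x` of `(x, M)`. -/
def trans (g : WaveletGroup A) : Fin d → ℝ := (SemidirectProduct.left g).toAdd

/-- The dilation part `M` of `(x, M)`. -/
def dil (g : WaveletGroup A) : Subgroup.zpowers A := SemidirectProduct.right g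

/-- The topology of `ℝᵈ ⋊ ⟨A⟩`: the product of the usual topology on `ℝᵈ` and the discrete
topology `⊥` on `⟨A⟩` (which need not be the topology inherited from `GL(d, ℝ)`). -/
instance : TopologicalSpace (WaveletGroup A) :=
  TopologicalSpace.induced trans inferInstance ⊓ TopologicalSpace.induced dil ⊥

end WaveletGroup

/-- The normalized translated and dilated function `t ↦ |det M|^{-1/2} f (M⁻¹ (t - x))`. -/
def translateDilate (x : Fin d → ℝ) (M : GL (Fin d) ℝ) (f : (Fin d → ℝ) → ℂ) :
    (Fin d → ℝ) → ℂ :=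
  fun t => ((|(M : Matrix (Fin d) (Fin d) ℝ).det| ^ (-(1 / 2) : ℝ) : ℝ) : ℂ) *
    f (((M⁻¹ : GL (Fin d) ℝ) : Matrix (Fin d) (Fin d) ℝ) *ᵥ (t - x))

theorem memLp_translateDilate (x : Fin d → ℝ) (M : GL (Fin d) ℝ) {f : (Fin d → ℝ) → ℂ}
    (hf : MemLp f 2 volume) : MemLp (translateDilate x M f) 2 volume := by
  refine MemLp.const_mul ?_ _
  set N : Matrix (Fin d) (Fin d) ℝ := ((M⁻¹ : GL (Fin d) ℝ) : Matrix (Fin d) (Fin d) ℝ)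
  have hN : N.det ≠ 0 := (Matrix.isUnit_iff_isUnit_det N).1 (M⁻¹).isUnit |>.ne_zero
  have hmap := Real.map_matrix_volume_pi_eq_smul_volume_pi hN
  have hmeas : Measurable (Matrix.toLin' N) :=
    (LinearMap.continuous_of_finiteDimensional _).measurable
  have h1 : MemLp f 2 (Measure.map (Matrix.toLin' N) volume) := by
    rw [hmap]
    exact hf.smul_measure ENNReal.ofReal_ne_top
  have h2 : MemLp (f ∘ Matrix.toLin' N) 2 volume :=
    (memLp_map_measure_iff h1.1 hmeas.aemeasurable).1 h1
  exact h2.comp_measurePreserving (measurePreserving_sub_right volume x)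

/-- The quasi-regular representation of `G = ℝᵈ ⋊ ⟨A⟩` on `L²(ℝᵈ)`:
`π(x, Aʲ) f (t) = |det A|^{-j/2} f (A⁻ʲ (t - x))`. -/
def quasiRegular (A : GL (Fin d) ℝ) (g : WaveletGroup A) (f : L2 d) : L2 d :=
  (memLp_translateDilate g.trans (g.dil : GL (Fin d) ℝ) (Lp.memLp f)).toLp

/-- The space `𝓑_π`: all `ψ ∈ L²(ℝᵈ)` such that `{π(λ) ψ}_{λ ∈ Λ}` is a Bessel family for every
relatively separated set `Λ ⊆ ℝᵈ ⋊ ⟨A⟩`. -/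
def besselVectors (A : GL (Fin d) ℝ) : Set (L2 d) :=
  {ψ | ∀ Λ : Set (WaveletGroup A), IsRelativelySeparated Λ →
    IsBesselFamily (fun l : Λ => quasiRegular A l ψ)}

/-- The element `(Aʲ P k, Aʲ)` of `ℝᵈ ⋊ ⟨A⟩`, for `j ∈ ℤ` and `k ∈ ℤᵈ`. -/
def waveletPoint (A P : GL (Fin d) ℝ) (j : ℤ) (k : Fin d → ℤ) : WaveletGroup A :=
  WaveletGroup.mk
    (((A ^ j : GL (Fin d) ℝ) : Matrix (Fin d) (Fin d) ℝ) *ᵥ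
      ((P : Matrix (Fin d) (Fin d) ℝ) *ᵥ fun i => (k i : ℝ)))
    ⟨A ^ j, Subgroup.zpow_mem_zpowers A j⟩

end

/-! Suppose |det A| = 1. Write T(f, g) for `totalCorrelation`, the sum over j of ∫ |⟨f, π(x, Aʲ)
g⟩|² dx, and κ = 1 / |det P|. Translating f shows that the Parseval identity holds for every shift
of the lattice. Integrating over shifts x in a large ball replaces each lattice sum by an integral,
up to dimensional constants. This gives κ T(f, ψ) ≤ 2^d ‖f‖² (`totalCorrelation_le`) and 2^d ‖f‖² ≤
2 · 3^d κ T(f, ψ) (`le_totalCorrelation`).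

The lower bound needs the tail in j to be small uniformly in the shift, because the radius can only
serve finitely many scales at once. This is where ψ ∈ 𝓑_π enters: near-maximal points, one in each
cell, form a relatively separated set, so the sum of the cell suprema is finite
(`tsum_cellSup_ne_top`).

The two bounds conflict under scaling. T is symmetric because |det A| = 1 (`totalCorrelation_swap`),
and a dilation S commuting with A multiplies T by |det S| when applied to both arguments
(`totalCorrelation_affineOp_of_commute`). Taking S = 8 gives T(Sψ, ψ) = 8^d T(S⁻¹ψ, ψ), while Sψ and
S⁻¹ψ have the norm of ψ. The bounds then force 8^d ≤ 2 · 3^d, which is false for d ≥ 1. -/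

noncomputable section

variable {d : ℕ}

/-! ### Unitary affine operators on L²(ℝᵈ), with the dilation not restricted to ⟨A⟩ -/

section AffineAction

open scoped ENNReal

/-- The affine map `t ↦ M⁻¹ (t - x)`. -/
def affineInv (x : Fin d → ℝ) (M : GL (Fin d) ℝ) (t : Fin d → ℝ) : Fin d → ℝ :=
  ((M⁻¹ : GL (Fin d) ℝ) : Matrix (Fin d) (Fin d) ℝ) *ᵥ (t - x)

theorem GL_det_ne_zero (M : GL (Fin d) ℝ) : (M : Matrix (Fin d) (Fin d) ℝ).det ≠ 0 :=
  (Matrix.isUnit_iff_isUnit_det _).1 M.isUnit |>.ne_zero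

theorem GL_det_inv (M : GL (Fin d) ℝ) :
    ((M⁻¹ : GL (Fin d) ℝ) : Matrix (Fin d) (Fin d) ℝ).det
      = ((M : Matrix (Fin d) (Fin d) ℝ).det)⁻¹ := by
  have h : ((M⁻¹ : GL (Fin d) ℝ) : Matrix (Fin d) (Fin d) ℝ).det
      * (M : Matrix (Fin d) (Fin d) ℝ).det = 1 := by
    rw [← Matrix.det_mul, ← Units.val_mul]; simp
  exact eq_inv_of_mul_eq_one_left h

theorem continuous_mulVec_left (N : Matrix (Fin d) (Fin d) ℝ) :
    Continuous fun t : Fin d → ℝ => N *ᵥ t :=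
  (LinearMap.continuous_of_finiteDimensional (Matrix.toLin' N) :)

theorem continuous_affineInv (x : Fin d → ℝ) (M : GL (Fin d) ℝ) :
    Continuous (affineInv x M) :=
  (continuous_mulVec_left _).comp (continuous_id.sub continuous_const)

theorem map_mulVec_volume (M : GL (Fin d) ℝ) :
    Measure.map (fun t : Fin d → ℝ => (M : Matrix (Fin d) (Fin d) ℝ) *ᵥ t) volume
      = ENNReal.ofReal |(M : Matrix (Fin d) (Fin d) ℝ).det|⁻¹ • volume := by
  have h := Real.map_matrix_volume_pi_eq_smul_volume_pi (GL_det_ne_zero M)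
  rw [abs_inv] at h
  exact h

theorem map_affineInv_volume (x : Fin d → ℝ) (M : GL (Fin d) ℝ) :
    Measure.map (affineInv x M) volume
      = ENNReal.ofReal |(M : Matrix (Fin d) (Fin d) ℝ).det| • volume := by
  have h := map_mulVec_volume (M⁻¹)
  rw [GL_det_inv, abs_inv, inv_inv] at h
  rw [← h]
  conv_rhs => rw [← (measurePreserving_sub_right volume x).map_eq]
  rw [Measure.map_map (continuous_mulVec_left _).measurable
    (measurePreserving_sub_right volume x).measurable]
  rfl

theorem quasiMeasurePreserving_affineInv (x : Fin d → ℝ) (M : GL (Fin d) ℝ) :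
    Measure.QuasiMeasurePreserving (affineInv x M) volume volume := by
  refine ⟨(continuous_affineInv x M).measurable, ?_⟩
  rw [map_affineInv_volume]
  exact Measure.smul_absolutelyContinuous

theorem lintegral_mulVec (M : GL (Fin d) ℝ) {φ : (Fin d → ℝ) → ℝ≥0∞} (hφ : Measurable φ) :
    ∫⁻ t, φ ((M : Matrix (Fin d) (Fin d) ℝ) *ᵥ t)
      = ENNReal.ofReal |(M : Matrix (Fin d) (Fin d) ℝ).det|⁻¹ * ∫⁻ t, φ t := by
  rw [← lintegral_map hφ (continuous_mulVec_left _).measurable, map_mulVec_volume,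
    lintegral_smul_measure, smul_eq_mul]

/-- The unitary operator `f ↦ |det M|^{-1/2} f (M⁻¹ (· - x))` on `L²(ℝᵈ)`. -/
def affineOp (x : Fin d → ℝ) (M : GL (Fin d) ℝ) (f : L2 d) : L2 d :=
  (memLp_translateDilate x M (Lp.memLp f)).toLp

theorem coeFn_affineOp (x : Fin d → ℝ) (M : GL (Fin d) ℝ) (f : L2 d) :
    affineOp x M f =ᵐ[volume] fun t =>
      ((|(M : Matrix (Fin d) (Fin d) ℝ).det| ^ (-(1 / 2) : ℝ) : ℝ) : ℂ) * f (affineInv x M t) :=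
  MemLp.coeFn_toLp _

theorem affineInv_comp (x y : Fin d → ℝ) (M N : GL (Fin d) ℝ) (t : Fin d → ℝ) :
    affineInv y N (affineInv x M t)
      = affineInv (x + (M : Matrix (Fin d) (Fin d) ℝ) *ᵥ y) (M * N) t := by
  have h : y = ((M⁻¹ : GL (Fin d) ℝ) : Matrix (Fin d) (Fin d) ℝ) *ᵥ
      ((M : Matrix (Fin d) (Fin d) ℝ) *ᵥ y) := by
    rw [Matrix.mulVec_mulVec, ← Units.val_mul]; simp
  unfold affineInv
  conv_lhs => rw [h]
  rw [← Matrix.mulVec_sub, Matrix.mulVec_mulVec, ← Units.val_mul, mul_inv_rev, sub_sub]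

theorem affineOp_affineOp (x y : Fin d → ℝ) (M N : GL (Fin d) ℝ) (f : L2 d) :
    affineOp x M (affineOp y N f)
      = affineOp (x + (M : Matrix (Fin d) (Fin d) ℝ) *ᵥ y) (M * N) f := by
  refine Lp.ext ?_
  filter_upwards [coeFn_affineOp x M (affineOp y N f),
    coeFn_affineOp (x + (M : Matrix (Fin d) (Fin d) ℝ) *ᵥ y) (M * N) f,
    (quasiMeasurePreserving_affineInv x M).ae_eq_comp (coeFn_affineOp y N f)] with t h1 h2 h3
  simp only [Function.comp_apply] at h3
  rw [h1, h2, h3, affineInv_comp, Units.val_mul, Matrix.det_mul, abs_mul,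
    Real.mul_rpow (abs_nonneg _) (abs_nonneg _)]
  push_cast
  ring

theorem affineOp_zero_one (f : L2 d) : affineOp 0 1 f = f := by
  refine Lp.ext ?_
  filter_upwards [coeFn_affineOp 0 1 f] with t h
  rw [h]
  simp [affineInv]

theorem inner_affineOp_affineOp (x : Fin d → ℝ) (M : GL (Fin d) ℝ) (f g : L2 d) :
    inner ℂ (affineOp x M f) (affineOp x M g) = inner ℂ f g := by
  have hpos : 0 < |(M : Matrix (Fin d) (Fin d) ℝ).det| := abs_pos.2 (GL_det_ne_zero M)
  have hc : (|(M : Matrix (Fin d) (Fin d) ℝ).det| ^ (-(1 / 2) : ℝ))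
      * (|(M : Matrix (Fin d) (Fin d) ℝ).det| ^ (-(1 / 2) : ℝ))
      = |(M : Matrix (Fin d) (Fin d) ℝ).det|⁻¹ := by
    rw [← Real.rpow_add hpos, ← Real.rpow_neg_one]; norm_num
  rw [L2.inner_def, L2.inner_def]
  have h1 : ∫ t, inner ℂ (affineOp x M f t) (affineOp x M g t)
      = ∫ t, ((|(M : Matrix (Fin d) (Fin d) ℝ).det|⁻¹ : ℝ) : ℂ) *
          inner ℂ (f (affineInv x M t)) (g (affineInv x M t)) := by
    refine integral_congr_ae ?_
    filter_upwards [coeFn_affineOp x M f, coeFn_affineOp x M g] with t h1 h2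
    rw [h1, h2, ← hc]
    simp only [RCLike.inner_apply, map_mul, Complex.conj_ofReal]
    push_cast
    ring
  rw [h1, integral_const_mul,
    ← integral_map (f := fun t => inner ℂ (f t) (g t)) (φ := affineInv x M)
      (continuous_affineInv x M).measurable.aemeasurable, map_affineInv_volume,
    integral_smul_measure, ENNReal.toReal_ofReal hpos.le, Complex.real_smul, ← mul_assoc,
    ← Complex.ofReal_mul, inv_mul_cancel₀ hpos.ne', Complex.ofReal_one, one_mul]
  rw [map_affineInv_volume]
  exact (((Lp.aestronglyMeasurable f).inner (Lp.aestronglyMeasurable g)).smul_measure _)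

theorem norm_affineOp (x : Fin d → ℝ) (M : GL (Fin d) ℝ) (f : L2 d) :
    ‖affineOp x M f‖ = ‖f‖ := by
  rw [norm_eq_sqrt_re_inner (𝕜 := ℂ), inner_affineOp_affineOp, ← norm_eq_sqrt_re_inner]

theorem enorm_affineOp (x : Fin d → ℝ) (M : GL (Fin d) ℝ) (f : L2 d) :
    ‖affineOp x M f‖ₑ = ‖f‖ₑ := by
  rw [← ofReal_norm, ← ofReal_norm, norm_affineOp]

theorem affineOp_one_eq_compMeasurePreserving (x : Fin d → ℝ) (f : L2 d) :
    affineOp x 1 f = Lp.compMeasurePreserving (fun t => t - x)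
      (measurePreserving_sub_right volume x) f := by
  refine Lp.ext ?_
  filter_upwards [coeFn_affineOp x 1 f, Lp.coeFn_compMeasurePreserving f
    (measurePreserving_sub_right volume x)] with t h1 h2
  rw [h1, h2]
  simp [affineInv]

/-- Strong continuity of translations on L², applied to the dilated function; it makes the
coefficients measurable in x. -/
theorem continuous_affineOp (M : GL (Fin d) ℝ) (f : L2 d) :
    Continuous fun x => affineOp x M f := by
  have h : (fun x => affineOp x M f) = fun x => Lp.compMeasurePreserving (fun t => t - x)
      (measurePreserving_sub_right volume x) (affineOp 0 M f) := by
    funext x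
    rw [← affineOp_one_eq_compMeasurePreserving, affineOp_affineOp, Matrix.mulVec_zero,
      add_zero, one_mul]
  rw [h]
  have hg : Continuous fun x : Fin d → ℝ =>
      (⟨fun t => t - x, by fun_prop⟩ : C(Fin d → ℝ, Fin d → ℝ)) :=
    ContinuousMap.continuous_of_continuous_uncurry _ (by simp only [Function.uncurry_def, ContinuousMap.coe_mk]; fun_prop)
  exact Continuous.compMeasurePreservingLp (continuous_const (y := affineOp 0 M f)) hg
    (fun x => measurePreserving_sub_right volume x) (by norm_num)

theorem inner_affineOp_left (x : Fin d → ℝ) (M : GL (Fin d) ℝ) (f g : L2 d) :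
    inner ℂ (affineOp x M g) f = inner ℂ g (affineOp
      (-(((M⁻¹ : GL (Fin d) ℝ) : Matrix (Fin d) (Fin d) ℝ) *ᵥ x)) M⁻¹ f) := by
  rw [← inner_affineOp_affineOp x M g, affineOp_affineOp, Matrix.mulVec_neg,
    Matrix.mulVec_mulVec, ← Units.val_mul]
  simp [affineOp_zero_one]

end AffineAction

/-! ### Comparing lattice sums with integrals -/

section LatticeAverage

open scoped ENNReal

/-- The floor map is constant on half-open unit cubes, each of volume one. -/
theorem lintegral_floor_eq_tsum (h : (Fin d → ℤ) → ℝ≥0∞) :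
    ∫⁻ u : Fin d → ℝ, h (fun i => ⌊u i⌋) = ∑' k, h k := by
  have hm : Measurable fun (u : Fin d → ℝ) i => ⌊u i⌋ :=
    measurable_pi_iff.2 fun i => (measurable_pi_apply i).floor
  rw [← lintegral_map (f := h) (measurable_of_countable h) hm, lintegral_countable']
  refine tsum_congr fun k => ?_
  rw [Measure.map_apply hm (measurableSet_singleton k)]
  have hpre : (fun (u : Fin d → ℝ) i => ⌊u i⌋) ⁻¹' {k}
      = Set.pi Set.univ fun i => Set.Ico (k i : ℝ) (k i + 1) := by
    ext u
    simp [funext_iff, Int.floor_eq_iff]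
  rw [hpre, Real.volume_pi_Ico]
  simp

theorem exists_norm_mulVec_le (L : Matrix (Fin d) (Fin d) ℝ) :
    ∃ D : ℝ, 0 ≤ D ∧ ∀ u : Fin d → ℝ, ‖u‖ ≤ 1 → ‖L *ᵥ u‖ ≤ D := by
  have h := (isCompact_closedBall (0 : Fin d → ℝ) 1).exists_bound_of_continuousOn
    (continuous_mulVec_left L).continuousOn
  obtain ⟨C, hC⟩ := h
  exact ⟨C, (norm_nonneg _).trans (hC 0 (by simp)), fun u hu => hC u (by simpa using hu)⟩

theorem norm_fract_le_one (u : Fin d → ℝ) : ‖fun i => Int.fract (u i)‖ ≤ 1 :=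
  (pi_norm_le_iff_of_nonneg zero_le_one).2 fun i => by
    rw [Real.norm_eq_abs, abs_of_nonneg (Int.fract_nonneg _)]
    exact (Int.fract_lt_one _).le

theorem mulVec_floor (L : Matrix (Fin d) (Fin d) ℝ) (u : Fin d → ℝ) :
    L *ᵥ (fun i => ((⌊u i⌋ : ℤ) : ℝ)) = L *ᵥ u - L *ᵥ fun i => Int.fract (u i) := by
  rw [← Matrix.mulVec_sub]
  congr 1
  ext i
  simp

theorem lintegral_indicator_sub_mulVec (L : GL (Fin d) ℝ) (R : ℝ) (hR : 0 ≤ R)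
    (y : Fin d → ℝ) :
    ∫⁻ u, (Metric.closedBall (0 : Fin d → ℝ) R).indicator (fun _ => (1 : ℝ≥0∞))
        (y - (L : Matrix (Fin d) (Fin d) ℝ) *ᵥ u)
      = ENNReal.ofReal |(L : Matrix (Fin d) (Fin d) ℝ).det|⁻¹ * ENNReal.ofReal ((2 * R) ^ d) := by
  have hm : Measurable ((Metric.closedBall (0 : Fin d → ℝ) R).indicator
      (fun _ => (1 : ℝ≥0∞))) := measurable_const.indicator Metric.isClosed_closedBall.measurableSet
  rw [lintegral_mulVec L (φ := fun v => (Metric.closedBall (0 : Fin d → ℝ) R).indicator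
      (fun _ => (1 : ℝ≥0∞)) (y - v)) (hm.comp (measurable_const.sub measurable_id)),
    lintegral_sub_left_eq_self (μ := volume), lintegral_indicator
      Metric.isClosed_closedBall.measurableSet]
  simp [Real.volume_pi_closedBall (0 : Fin d → ℝ) hR]

/-- Rounding u down to ⌊u⌋ moves L u by at most D, so the number of lattice points in a ball of
radius R lies between the normalized volumes of the balls of radius R - D and R + D. -/
theorem tsum_indicator_sub_mulVec_bounds (L : GL (Fin d) ℝ) {D R : ℝ} (hD : 0 ≤ D)
    (hDL : ∀ u : Fin d → ℝ, ‖u‖ ≤ 1 → ‖(L : Matrix (Fin d) (Fin d) ℝ) *ᵥ u‖ ≤ D)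
    (hDR : D ≤ R) (y : Fin d → ℝ) :
    ENNReal.ofReal |(L : Matrix (Fin d) (Fin d) ℝ).det|⁻¹ * ENNReal.ofReal ((2 * (R - D)) ^ d)
      ≤ ∑' k : Fin d → ℤ, (Metric.closedBall (0 : Fin d → ℝ) R).indicator (fun _ => (1 : ℝ≥0∞))
        (y - (L : Matrix (Fin d) (Fin d) ℝ) *ᵥ fun i => (k i : ℝ)) ∧
    ∑' k : Fin d → ℤ, (Metric.closedBall (0 : Fin d → ℝ) R).indicator (fun _ => (1 : ℝ≥0∞))
        (y - (L : Matrix (Fin d) (Fin d) ℝ) *ᵥ fun i => (k i : ℝ))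
      ≤ ENNReal.ofReal |(L : Matrix (Fin d) (Fin d) ℝ).det|⁻¹ *
        ENNReal.ofReal ((2 * (R + D)) ^ d) := by
  have hmono : ∀ (r r' : ℝ) (v w : Fin d → ℝ), (‖v‖ ≤ r → ‖w‖ ≤ r') →
      (Metric.closedBall (0 : Fin d → ℝ) r).indicator (fun _ => (1 : ℝ≥0∞)) v
        ≤ (Metric.closedBall (0 : Fin d → ℝ) r').indicator (fun _ => (1 : ℝ≥0∞)) w := by
    intro r r' v w h
    by_cases hv : ‖v‖ ≤ r
    · rw [Set.indicator_of_mem (by simpa using hv), Set.indicator_of_mem (by simpa using h hv)]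
    · rw [Set.indicator_of_notMem (by simpa using hv)]
      exact zero_le
  have key : ∀ u : Fin d → ℝ, ‖(y - (L : Matrix (Fin d) (Fin d) ℝ) *ᵥ u) -
      (y - (L : Matrix (Fin d) (Fin d) ℝ) *ᵥ fun i => ((⌊u i⌋ : ℤ) : ℝ))‖ ≤ D := by
    intro u
    rw [mulVec_floor]
    have := hDL _ (norm_fract_le_one u)
    have e : (y - (L : Matrix (Fin d) (Fin d) ℝ) *ᵥ u) -
      (y - ((L : Matrix (Fin d) (Fin d) ℝ) *ᵥ u - (L : Matrix (Fin d) (Fin d) ℝ) *ᵥ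
        fun i => Int.fract (u i))) = -((L : Matrix (Fin d) (Fin d) ℝ) *ᵥ
        fun i => Int.fract (u i)) := by abel
    rwa [e, norm_neg]
  rw [← lintegral_floor_eq_tsum (fun k : Fin d → ℤ =>
    (Metric.closedBall (0 : Fin d → ℝ) R).indicator (fun _ => (1 : ℝ≥0∞))
        (y - (L : Matrix (Fin d) (Fin d) ℝ) *ᵥ fun i => (k i : ℝ))),
    ← lintegral_indicator_sub_mulVec L (R - D) (by linarith) y,
    ← lintegral_indicator_sub_mulVec L (R + D) (by linarith) y]
  refine ⟨lintegral_mono fun u => hmono _ _ _ _ fun h => ?_,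
    lintegral_mono fun u => hmono _ _ _ _ fun h => ?_⟩
  · have := norm_le_norm_add_norm_sub' (y - (L : Matrix (Fin d) (Fin d) ℝ) *ᵥ fun i => ((⌊u i⌋ : ℤ) : ℝ))
      (y - (L : Matrix (Fin d) (Fin d) ℝ) *ᵥ u)
    have := key u
    rw [norm_sub_rev] at this
    linarith
  · have := norm_le_norm_add_norm_sub' (y - (L : Matrix (Fin d) (Fin d) ℝ) *ᵥ u)
      (y - (L : Matrix (Fin d) (Fin d) ℝ) *ᵥ fun i => ((⌊u i⌋ : ℤ) : ℝ))
    have := key u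
    linarith

/-- Tonelli, with y = x + L k substituted in each term. -/
theorem setLIntegral_tsum_add_mulVec (L : GL (Fin d) ℝ) (R : ℝ)
    {n : (Fin d → ℝ) → ℝ≥0∞} (hn : Measurable n) :
    ∫⁻ x in Metric.closedBall (0 : Fin d → ℝ) R,
        ∑' k : Fin d → ℤ, n (x + (L : Matrix (Fin d) (Fin d) ℝ) *ᵥ fun i => (k i : ℝ))
      = ∫⁻ y, n y * ∑' k : Fin d → ℤ,
          (Metric.closedBall (0 : Fin d → ℝ) R).indicator (fun _ => (1 : ℝ≥0∞))
            (y - (L : Matrix (Fin d) (Fin d) ℝ) *ᵥ fun i => (k i : ℝ)) := by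
  have hm : Measurable ((Metric.closedBall (0 : Fin d → ℝ) R).indicator
      (fun _ => (1 : ℝ≥0∞))) := measurable_const.indicator Metric.isClosed_closedBall.measurableSet
  have hsub : ∀ v : Fin d → ℝ, Measurable fun y : Fin d → ℝ => y - v :=
    fun v => measurable_id.sub measurable_const
  have hadd : ∀ v : Fin d → ℝ, Measurable fun y : Fin d → ℝ => n (y + v) :=
    fun v => hn.comp (measurable_id.add measurable_const)
  have hprod : ∀ v : Fin d → ℝ, Measurable fun y : Fin d → ℝ => n y *
      (Metric.closedBall (0 : Fin d → ℝ) R).indicator (fun _ => (1 : ℝ≥0∞)) (y - v) :=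
    fun v => hn.mul (hm.comp (hsub v))
  simp_rw [← ENNReal.tsum_mul_left]
  rw [lintegral_tsum fun k => (hadd _).aemeasurable,
    lintegral_tsum fun k => (hprod _).aemeasurable]
  refine tsum_congr fun k => ?_
  rw [← lintegral_indicator Metric.isClosed_closedBall.measurableSet,
    ← lintegral_sub_right_eq_self (μ := volume) _
      ((L : Matrix (Fin d) (Fin d) ℝ) *ᵥ fun i => (k i : ℝ))]
  refine lintegral_congr fun y => ?_
  by_cases h : y - ((L : Matrix (Fin d) (Fin d) ℝ) *ᵥ fun i => (k i : ℝ))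
      ∈ Metric.closedBall (0 : Fin d → ℝ) R
  · rw [Set.indicator_of_mem h, Set.indicator_of_mem h, sub_add_cancel, mul_one]
  · rw [Set.indicator_of_notMem h, Set.indicator_of_notMem h, mul_zero]

theorem setLIntegral_tsum_add_mulVec_bounds (L : GL (Fin d) ℝ) {D R : ℝ} (hD : 0 ≤ D)
    (hDL : ∀ u : Fin d → ℝ, ‖u‖ ≤ 1 → ‖(L : Matrix (Fin d) (Fin d) ℝ) *ᵥ u‖ ≤ D)
    (hDR : D ≤ R) {n : (Fin d → ℝ) → ℝ≥0∞} (hn : Measurable n) :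
    ENNReal.ofReal |(L : Matrix (Fin d) (Fin d) ℝ).det|⁻¹ * ENNReal.ofReal ((2 * (R - D)) ^ d)
        * ∫⁻ y, n y
      ≤ ∫⁻ x in Metric.closedBall (0 : Fin d → ℝ) R,
        ∑' k : Fin d → ℤ, n (x + (L : Matrix (Fin d) (Fin d) ℝ) *ᵥ fun i => (k i : ℝ)) ∧
    ∫⁻ x in Metric.closedBall (0 : Fin d → ℝ) R,
        ∑' k : Fin d → ℤ, n (x + (L : Matrix (Fin d) (Fin d) ℝ) *ᵥ fun i => (k i : ℝ))
      ≤ ENNReal.ofReal |(L : Matrix (Fin d) (Fin d) ℝ).det|⁻¹ *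
        ENNReal.ofReal ((2 * (R + D)) ^ d) * ∫⁻ y, n y := by
  rw [setLIntegral_tsum_add_mulVec L R hn, ← lintegral_const_mul _ hn,
    ← lintegral_const_mul _ hn]
  refine ⟨lintegral_mono fun y => ?_, lintegral_mono fun y => ?_⟩
  · rw [mul_comm]
    exact mul_le_mul_right (tsum_indicator_sub_mulVec_bounds L hD hDL hDR y).1 _
  · rw [mul_comm (ENNReal.ofReal _ * _)]
    exact mul_le_mul_right (tsum_indicator_sub_mulVec_bounds L hD hDL hDR y).2 _

end LatticeAverage

/-! ### Coefficients integrated over the group, and their symmetries -/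

section Correlation

open scoped ENNReal

/-- The squared coefficient `|⟨f, π(x, M) g⟩|²`. -/
def coeffSq (f g : L2 d) (M : GL (Fin d) ℝ) (x : Fin d → ℝ) : ℝ≥0∞ :=
  ‖(inner ℂ (affineOp x M g) f : ℂ)‖ₑ ^ 2

theorem measurable_coeffSq (f g : L2 d) (M : GL (Fin d) ℝ) : Measurable (coeffSq f g M) := by
  have h : Continuous fun x => (inner ℂ (affineOp x M g) f : ℂ) :=
    (continuous_affineOp M g).inner continuous_const
  exact h.measurable.enorm.pow_const 2

theorem coeffSq_swap (f g : L2 d) (M : GL (Fin d) ℝ) (x : Fin d → ℝ) :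
    coeffSq f g M x = coeffSq g f M⁻¹
      (-(((M⁻¹ : GL (Fin d) ℝ) : Matrix (Fin d) (Fin d) ℝ) *ᵥ x)) := by
  unfold coeffSq
  rw [inner_affineOp_left, ← inner_conj_symm, RCLike.enorm_conj]

/-- The integral over translations `∫ |⟨f, π(x, M) g⟩|² dx`. -/
def correlation (f g : L2 d) (M : GL (Fin d) ℝ) : ℝ≥0∞ := ∫⁻ x, coeffSq f g M x

/-- Unitarity moves π(x, M) to the other side as its inverse; the substitution x ↦ -M⁻¹ x preserves
volume exactly because |det M| = 1. -/
theorem correlation_swap (f g : L2 d) {M : GL (Fin d) ℝ}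
    (hM : |(M : Matrix (Fin d) (Fin d) ℝ).det| = 1) :
    correlation f g M = correlation g f M⁻¹ := by
  unfold correlation
  simp_rw [coeffSq_swap f g M]
  rw [lintegral_mulVec M⁻¹ (φ := fun x => coeffSq g f M⁻¹ (-x))
    ((measurable_coeffSq g f M⁻¹).comp measurable_neg), GL_det_inv, abs_inv, hM]
  simp only [inv_one, ENNReal.ofReal_one, one_mul]
  exact lintegral_neg_eq_self (μ := volume) (coeffSq g f M⁻¹)

/-- Moving the dilation by S past π(x, M) turns x into S⁻¹ x and leaves M alone; the Jacobian of
this substitution is the factor. -/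
theorem correlation_affineOp_of_commute (f g : L2 d) {M S : GL (Fin d) ℝ} (hMS : Commute M S) :
    correlation (affineOp 0 S f) (affineOp 0 S g) M
      = ENNReal.ofReal |(S : Matrix (Fin d) (Fin d) ℝ).det| * correlation f g M := by
  have h : ∀ x, coeffSq (affineOp 0 S f) (affineOp 0 S g) M x
      = coeffSq f g M (((S⁻¹ : GL (Fin d) ℝ) : Matrix (Fin d) (Fin d) ℝ) *ᵥ x) := by
    intro x
    unfold coeffSq
    have e : affineOp x M (affineOp 0 S g) = affineOp 0 S (affineOp
        (((S⁻¹ : GL (Fin d) ℝ) : Matrix (Fin d) (Fin d) ℝ) *ᵥ x) M g) := by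
      rw [affineOp_affineOp, affineOp_affineOp, hMS.eq, Matrix.mulVec_mulVec, ← Units.val_mul,
        mul_inv_cancel, Matrix.mulVec_zero, add_zero, zero_add, Units.val_one, Matrix.one_mulVec]
    rw [e, inner_affineOp_affineOp]
  unfold correlation
  simp_rw [h]
  rw [lintegral_mulVec S⁻¹ (measurable_coeffSq f g M), GL_det_inv, abs_inv, inv_inv]

/-- The integral of `|⟨f, π(·) g⟩|²` over `ℝᵈ × ℤ`, where `j : ℤ` stands for `Aʲ`. -/
def totalCorrelation (A : GL (Fin d) ℝ) (f g : L2 d) : ℝ≥0∞ :=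
  ∑' j : ℤ, correlation f g (A ^ j)

theorem abs_det_zpow {A : GL (Fin d) ℝ} (hA : |(A : Matrix (Fin d) (Fin d) ℝ).det| = 1) (j : ℤ) :
    |((A ^ j : GL (Fin d) ℝ) : Matrix (Fin d) (Fin d) ℝ).det| = 1 := by
  have h := congrArg (fun u : ℝˣ => |(u : ℝ)|) (map_zpow Matrix.GeneralLinearGroup.det A j)
  simp only [Matrix.GeneralLinearGroup.val_det_apply, Units.val_zpow_eq_zpow_val, abs_zpow, hA,
    one_zpow] at h
  exact h

theorem totalCorrelation_swap {A : GL (Fin d) ℝ}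
    (hA : |(A : Matrix (Fin d) (Fin d) ℝ).det| = 1) (f g : L2 d) :
    totalCorrelation A f g = totalCorrelation A g f := by
  unfold totalCorrelation
  rw [← (Equiv.neg ℤ).tsum_eq]
  refine tsum_congr fun j => ?_
  rw [correlation_swap f g (abs_det_zpow hA _)]
  simp

theorem totalCorrelation_affineOp_of_commute (f g : L2 d) {A S : GL (Fin d) ℝ}
    (hAS : Commute A S) :
    totalCorrelation A (affineOp 0 S f) (affineOp 0 S g)
      = ENNReal.ofReal |(S : Matrix (Fin d) (Fin d) ℝ).det| * totalCorrelation A f g := by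
  unfold totalCorrelation
  rw [← ENNReal.tsum_mul_left]
  exact tsum_congr fun j => correlation_affineOp_of_commute f g (hAS.zpow_left j)

end Correlation

/-! ### Two-sided bounds from averaging over shifts -/

section CalderonBounds

open scoped ENNReal

/-- The sum of `|⟨f, π(x + Aʲ P k, Aʲ) ψ⟩|²` over `k ∈ ℤᵈ`. -/
def scaleSum (A P : GL (Fin d) ℝ) (f ψ : L2 d) (j : ℤ) (x : Fin d → ℝ) : ℝ≥0∞ :=
  ∑' k : Fin d → ℤ, coeffSq f ψ (A ^ j)
    (x + ((A ^ j * P : GL (Fin d) ℝ) : Matrix (Fin d) (Fin d) ℝ) *ᵥ fun i => (k i : ℝ))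

theorem measurable_scaleSum (A P : GL (Fin d) ℝ) (f ψ : L2 d) (j : ℤ) :
    Measurable (scaleSum A P f ψ j) :=
  Measurable.tsum fun _ =>
    (measurable_coeffSq f ψ (A ^ j)).comp (measurable_id.add measurable_const)

theorem exists_setLIntegral_scaleSum_bounds {A : GL (Fin d) ℝ}
    (hA : |(A : Matrix (Fin d) (Fin d) ℝ).det| = 1) (P : GL (Fin d) ℝ) (f ψ : L2 d)
    (J : Finset ℤ) : ∃ R : ℝ, 0 < R ∧ ∀ j ∈ J,
      ENNReal.ofReal |(P : Matrix (Fin d) (Fin d) ℝ).det|⁻¹ * ENNReal.ofReal (R ^ d)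
          * correlation f ψ (A ^ j)
        ≤ ∫⁻ x in Metric.closedBall (0 : Fin d → ℝ) R, scaleSum A P f ψ j x ∧
      ∫⁻ x in Metric.closedBall (0 : Fin d → ℝ) R, scaleSum A P f ψ j x
        ≤ ENNReal.ofReal |(P : Matrix (Fin d) (Fin d) ℝ).det|⁻¹ * ENNReal.ofReal ((3 * R) ^ d)
          * correlation f ψ (A ^ j) := by
  choose D hD0 hD using fun j : ℤ =>
    exists_norm_mulVec_le ((A ^ j * P : GL (Fin d) ℝ) : Matrix (Fin d) (Fin d) ℝ)
  have hs : 0 ≤ ∑ j ∈ J, D j := Finset.sum_nonneg fun j _ => hD0 j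
  -- This radius gives D j ≤ R / 2 for all j ∈ J, hence R ≤ 2 (R - D j) and 2 (R + D j) ≤ 3 R. No
  -- single radius need work for all j ∈ ℤ, as the cells of Aʲ P may grow without bound.
  refine ⟨1 + 2 * ∑ j ∈ J, D j, by linarith, fun j hj => ?_⟩
  set R := 1 + 2 * ∑ j ∈ J, D j
  have hle : 2 * D j ≤ R := by
    have := Finset.single_le_sum (fun i _ => hD0 i) hj
    simp only [R]; linarith
  have h0 := hD0 j
  have hdet : |((A ^ j * P : GL (Fin d) ℝ) : Matrix (Fin d) (Fin d) ℝ).det|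
      = |(P : Matrix (Fin d) (Fin d) ℝ).det| := by
    rw [Units.val_mul, Matrix.det_mul, abs_mul, abs_det_zpow hA, one_mul]
  have h := setLIntegral_tsum_add_mulVec_bounds (A ^ j * P) h0 (hD j) (by linarith : D j ≤ R)
    (measurable_coeffSq f ψ (A ^ j))
  rw [hdet] at h
  have h1 : R ^ d ≤ (2 * (R - D j)) ^ d := pow_le_pow_left₀ (by linarith) (by linarith) d
  have h2 : (2 * (R + D j)) ^ d ≤ (3 * R) ^ d := pow_le_pow_left₀ (by linarith) (by linarith) d
  unfold correlation
  exact ⟨le_trans (by gcongr) h.1, h.2.trans (by gcongr)⟩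

theorem volume_closedBall_zero {R : ℝ} (hR : 0 < R) :
    volume (Metric.closedBall (0 : Fin d → ℝ) R) = 2 ^ d * ENNReal.ofReal (R ^ d) := by
  rw [Real.volume_pi_closedBall _ hR.le, mul_pow, ENNReal.ofReal_mul (by positivity),
    Fintype.card_fin, ENNReal.ofReal_pow zero_le_two]
  simp

theorem totalCorrelation_le {A P : GL (Fin d) ℝ}
    (hA : |(A : Matrix (Fin d) (Fin d) ℝ).det| = 1) (f ψ : L2 d)
    (hsum : ∀ x, ∑' j, scaleSum A P f ψ j x = ‖f‖ₑ ^ 2) :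
    ENNReal.ofReal |(P : Matrix (Fin d) (Fin d) ℝ).det|⁻¹ * totalCorrelation A f ψ
      ≤ 2 ^ d * ‖f‖ₑ ^ 2 := by
  unfold totalCorrelation
  rw [← ENNReal.tsum_mul_left]
  refine ENNReal.summable.tsum_le_of_sum_le fun J => ?_
  obtain ⟨R, hR, hJ⟩ := exists_setLIntegral_scaleSum_bounds hA P f ψ J
  have hRd : ENNReal.ofReal (R ^ d) ≠ 0 := by simpa using pow_pos hR d
  refine (ENNReal.mul_le_mul_iff_right hRd ENNReal.ofReal_ne_top).1 ?_
  calc ENNReal.ofReal (R ^ d) * ∑ j ∈ J,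
        ENNReal.ofReal |(P : Matrix (Fin d) (Fin d) ℝ).det|⁻¹ * correlation f ψ (A ^ j)
      ≤ ∑ j ∈ J, ∫⁻ x in Metric.closedBall (0 : Fin d → ℝ) R, scaleSum A P f ψ j x := by
        rw [Finset.mul_sum]
        refine Finset.sum_le_sum fun j hj => le_trans (le_of_eq ?_) (hJ j hj).1
        ring
    _ = ∫⁻ x in Metric.closedBall (0 : Fin d → ℝ) R, ∑ j ∈ J, scaleSum A P f ψ j x :=
        (lintegral_finsetSum _ fun j _ => measurable_scaleSum A P f ψ j).symm
    _ ≤ ∫⁻ _ in Metric.closedBall (0 : Fin d → ℝ) R, ‖f‖ₑ ^ 2 := by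
        refine lintegral_mono fun x => ?_
        rw [← hsum x]
        exact ENNReal.sum_le_tsum J
    _ = ENNReal.ofReal (R ^ d) * (2 ^ d * ‖f‖ₑ ^ 2) := by
        rw [setLIntegral_const, volume_closedBall_zero hR]
        ring

/-- The majorant `a` makes the tail in j uniformly small in x, so finitely many scales carry at
least half of ‖f‖² at every shift. That half is the source of the constant 2, and 3^d comes from the
upper volume estimate. -/
theorem le_totalCorrelation {A P : GL (Fin d) ℝ}
    (hA : |(A : Matrix (Fin d) (Fin d) ℝ).det| = 1) (f ψ : L2 d)
    (hsum : ∀ x, ∑' j, scaleSum A P f ψ j x = ‖f‖ₑ ^ 2) {a : ℤ → ℝ≥0∞}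
    (ha : ∑' j, a j ≠ ∞) (hle : ∀ j x, scaleSum A P f ψ j x ≤ a j) :
    2 ^ d * ‖f‖ₑ ^ 2 ≤ 2 * 3 ^ d *
      (ENNReal.ofReal |(P : Matrix (Fin d) (Fin d) ℝ).det|⁻¹ * totalCorrelation A f ψ) := by
  by_cases hf : f = 0
  · simp [hf]
  have hf0 : ‖f‖ₑ ^ 2 ≠ 0 := by simpa using hf
  have hft : ‖f‖ₑ ^ 2 ≠ ∞ := ENNReal.pow_ne_top enorm_ne_top
  obtain ⟨J, hJ⟩ : ∃ J : Finset ℤ, ∑' j : { j // j ∉ J }, a j < ‖f‖ₑ ^ 2 / 2 :=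
    ((ENNReal.tendsto_tsum_compl_atTop_zero ha).eventually_lt_const
      (ENNReal.half_pos hf0)).exists
  have hhalf : ∀ x, ‖f‖ₑ ^ 2 / 2 ≤ ∑ j ∈ J, scaleSum A P f ψ j x := by
    intro x
    have hsplit : ∑ j ∈ J, scaleSum A P f ψ j x + ∑' j : { j // j ∉ J }, scaleSum A P f ψ j x
        = ‖f‖ₑ ^ 2 :=
      (ENNReal.sum_add_tsum_compl J fun j => scaleSum A P f ψ j x).trans (hsum x)
    have htail : ∑' j : { j // j ∉ J }, scaleSum A P f ψ j x ≤ ‖f‖ₑ ^ 2 / 2 :=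
      (ENNReal.tsum_le_tsum fun j : { j // j ∉ J } => hle j.1 x).trans hJ.le
    have h2 : ‖f‖ₑ ^ 2 / 2 + ‖f‖ₑ ^ 2 / 2
        ≤ ∑ j ∈ J, scaleSum A P f ψ j x + ‖f‖ₑ ^ 2 / 2 :=
      calc ‖f‖ₑ ^ 2 / 2 + ‖f‖ₑ ^ 2 / 2 = _ := (ENNReal.add_halves _).trans hsplit.symm
        _ ≤ _ := add_le_add_right htail _
    exact (ENNReal.add_le_add_iff_right (ENNReal.div_ne_top hft two_ne_zero)).1 h2
  obtain ⟨R, hR, hJR⟩ := exists_setLIntegral_scaleSum_bounds hA P f ψ J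
  have hRd : ENNReal.ofReal (R ^ d) ≠ 0 := by simpa using pow_pos hR d
  have h3 : ENNReal.ofReal ((3 * R) ^ d) = 3 ^ d * ENNReal.ofReal (R ^ d) := by
    rw [mul_pow, ENNReal.ofReal_mul (by positivity), ENNReal.ofReal_pow (by norm_num)]
    simp
  have hmain : ENNReal.ofReal (R ^ d) * (2 ^ d * (‖f‖ₑ ^ 2 / 2)) ≤ ENNReal.ofReal (R ^ d) *
      (3 ^ d * (ENNReal.ofReal |(P : Matrix (Fin d) (Fin d) ℝ).det|⁻¹ *
        totalCorrelation A f ψ)) :=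
    calc ENNReal.ofReal (R ^ d) * (2 ^ d * (‖f‖ₑ ^ 2 / 2))
        = ∫⁻ _ in Metric.closedBall (0 : Fin d → ℝ) R, ‖f‖ₑ ^ 2 / 2 := by
          rw [setLIntegral_const, volume_closedBall_zero hR]
          ring
      _ ≤ ∫⁻ x in Metric.closedBall (0 : Fin d → ℝ) R, ∑ j ∈ J, scaleSum A P f ψ j x :=
          lintegral_mono hhalf
      _ = ∑ j ∈ J, ∫⁻ x in Metric.closedBall (0 : Fin d → ℝ) R, scaleSum A P f ψ j x :=
          lintegral_finsetSum _ fun j _ => measurable_scaleSum A P f ψ j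
      _ ≤ ∑ j ∈ J, ENNReal.ofReal |(P : Matrix (Fin d) (Fin d) ℝ).det|⁻¹ *
            ENNReal.ofReal ((3 * R) ^ d) * correlation f ψ (A ^ j) :=
          Finset.sum_le_sum fun j hj => (hJR j hj).2
      _ ≤ ENNReal.ofReal |(P : Matrix (Fin d) (Fin d) ℝ).det|⁻¹ *
            ENNReal.ofReal ((3 * R) ^ d) * totalCorrelation A f ψ := by
          rw [← Finset.mul_sum]
          gcongr
          exact ENNReal.sum_le_tsum J
      _ = _ := by
          rw [h3]
          ring
  have hmain' := (ENNReal.mul_le_mul_iff_right hRd ENNReal.ofReal_ne_top).1 hmain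
  calc 2 ^ d * ‖f‖ₑ ^ 2 = 2 * (2 ^ d * (‖f‖ₑ ^ 2 / 2)) := by
        rw [mul_left_comm, ENNReal.mul_div_cancel two_ne_zero ENNReal.ofNat_ne_top]
    _ ≤ _ := by
        rw [mul_assoc 2]
        gcongr

end CalderonBounds

/-! ### Consequences of the Parseval identity -/

section FrameSums

open scoped ENNReal

theorem enorm_sq_eq_ofReal {E : Type*} [SeminormedAddCommGroup E] (z : E) :
    ‖z‖ₑ ^ 2 = ENNReal.ofReal (‖z‖ ^ 2) := by
  rw [← ofReal_norm, ENNReal.ofReal_pow (norm_nonneg _)]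

theorem IsParsevalFrame.tsum_enorm_sq {H ι : Type*} [NormedAddCommGroup H]
    [InnerProductSpace ℂ H] {v : ι → H} (hv : IsParsevalFrame v) (f : H) :
    ∑' i, ‖(inner ℂ (v i) f : ℂ)‖ₑ ^ 2 = ‖f‖ₑ ^ 2 := by
  simp_rw [enorm_sq_eq_ofReal]
  rw [← ENNReal.ofReal_tsum_of_nonneg (fun i => sq_nonneg _) (hv f).summable, (hv f).tsum_eq]

theorem coeffSq_add (f ψ : L2 d) (M : GL (Fin d) ℝ) (x y : Fin d → ℝ) :
    coeffSq f ψ M (x + y) = coeffSq (affineOp (-x) 1 f) ψ M y := by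
  have h : affineOp (x + y) M ψ = affineOp x 1 (affineOp y M ψ) := by
    rw [affineOp_affineOp, Units.val_one, Matrix.one_mulVec, one_mul]
  unfold coeffSq
  rw [h, inner_affineOp_left, inv_one, Units.val_one, Matrix.one_mulVec]

theorem tsum_scaleSum_of_isParsevalFrame {A P : GL (Fin d) ℝ} {ψ : L2 d}
    (hψ : IsParsevalFrame (fun jk : ℤ × (Fin d → ℤ) =>
        quasiRegular A (waveletPoint A P jk.1 jk.2) ψ)) (f : L2 d) (x : Fin d → ℝ) :
    ∑' j, scaleSum A P f ψ j x = ‖f‖ₑ ^ 2 := by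
  rw [← enorm_affineOp (-x) 1 f, ← hψ.tsum_enorm_sq, ENNReal.tsum_prod']
  refine tsum_congr fun j => tsum_congr fun k => ?_
  rw [coeffSq_add, Units.val_mul, ← Matrix.mulVec_mulVec]
  -- `quasiRegular` at a wavelet point is by definition `affineOp` with the same translation and
  -- dilation.
  rfl

theorem exists_L2_ne_zero (d : ℕ) : ∃ f : L2 d, f ≠ 0 := by
  have hfin : volume (Metric.closedBall (0 : Fin d → ℝ) 1) ≠ ∞ := by
    rw [volume_closedBall_zero one_pos]
    exact ENNReal.mul_ne_top (ENNReal.pow_ne_top ENNReal.ofNat_ne_top) ENNReal.ofReal_ne_top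
  have hpos : volume.real (Metric.closedBall (0 : Fin d → ℝ) 1) ≠ 0 := by
    rw [Measure.real, volume_closedBall_zero one_pos]
    simp
  refine ⟨indicatorConstLp 2 Metric.isClosed_closedBall.measurableSet hfin 1, ?_⟩
  rw [← norm_ne_zero_iff, norm_indicatorConstLp two_ne_zero ENNReal.ofNat_ne_top, norm_one, one_mul]
  exact (Real.rpow_pos_of_pos (lt_of_le_of_ne measureReal_nonneg hpos.symm) _).ne'

theorem affineOp_zero (x : Fin d → ℝ) (M : GL (Fin d) ℝ) : affineOp x M 0 = 0 := by
  rw [← norm_eq_zero, norm_affineOp, norm_zero]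

theorem ne_zero_of_tsum_scaleSum {A P : GL (Fin d) ℝ} {ψ : L2 d}
    (hsum : ∀ f x, ∑' j, scaleSum A P f ψ j x = ‖f‖ₑ ^ 2) : ψ ≠ 0 := by
  rintro rfl
  obtain ⟨f, hf⟩ := exists_L2_ne_zero d
  refine hf ?_
  have h := hsum f 0
  have h0 : 0 = ‖f‖ₑ ^ 2 := by simpa [scaleSum, coeffSq, affineOp_zero] using h
  simpa using h0.symm

/-- If A had finite order, each scale would recur infinitely often, so the sum over j could only be
0 or ∞. Injectivity is what later makes points of different scales distinct in the group. -/
theorem zpow_injective_of_tsum_scaleSum {A P : GL (Fin d) ℝ} {ψ : L2 d}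
    (hsum : ∀ f x, ∑' j, scaleSum A P f ψ j x = ‖f‖ₑ ^ 2) :
    Function.Injective fun j : ℤ => A ^ j := by
  rw [injective_zpow_iff_not_isOfFinOrder, isOfFinOrder_iff_pow_eq_one]
  rintro ⟨n, hn, hAn⟩
  obtain ⟨f, hf⟩ := exists_L2_ne_zero d
  have hper : ∀ j m : ℤ, scaleSum A P f ψ (j + n * m) 0 = scaleSum A P f ψ j 0 := by
    intro j m
    have h : A ^ (j + n * m) = A ^ j := by
      rw [zpow_add, zpow_mul, zpow_natCast, hAn, one_zpow, mul_one]
    unfold scaleSum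
    rw [h]
  have hzero : ∀ j, scaleSum A P f ψ j 0 = 0 := by
    intro j
    by_contra hj
    have hinj : Function.Injective fun m : ℤ => j + n * m := fun m m' h => by
      simpa [hn.ne'] using h
    have hle := ENNReal.tsum_comp_le_tsum_of_injective hinj fun j => scaleSum A P f ψ j 0
    simp_rw [hper j] at hle
    rw [hsum f 0, ENNReal.tsum_const_eq_top_of_ne_zero hj, top_le_iff] at hle
    exact ENNReal.pow_ne_top enorm_ne_top hle
  have h := hsum f 0
  simp_rw [hzero, tsum_zero] at h
  exact hf (by simpa using h.symm)

end FrameSums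

/-! ### Relatively separated sets and uniform summability over cells -/

section RelativelySeparated

open scoped ENNReal

namespace WaveletGroup

variable {A : GL (Fin d) ℝ}

theorem trans_mul (g h : WaveletGroup A) : (g * h).trans
    = g.trans + ((g.dil : GL (Fin d) ℝ) : Matrix (Fin d) (Fin d) ℝ) *ᵥ h.trans := rfl

theorem dil_mul (g h : WaveletGroup A) : (g * h).dil = g.dil * h.dil := rfl

theorem continuous_trans : Continuous (trans : WaveletGroup A → Fin d → ℝ) :=
  continuous_iff_le_induced.2 (inf_le_left (a := TopologicalSpace.induced trans inferInstance)
    (b := TopologicalSpace.induced dil ⊥))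

theorem isOpen_dil_preimage (s : Set (Subgroup.zpowers A)) :
    IsOpen (dil ⁻¹' s : Set (WaveletGroup A)) := by
  have h : @Continuous (WaveletGroup A) (Subgroup.zpowers A) _ ⊥ dil :=
    (@continuous_iff_le_induced _ _ _ _ ⊥).2
      (inf_le_right (a := TopologicalSpace.induced trans inferInstance)
        (b := TopologicalSpace.induced dil ⊥))
  exact @IsOpen.preimage _ _ _ ⊥ _ h s trivial

end WaveletGroup

/-- The point `(Aʲ P v, Aʲ)` of `ℝᵈ ⋊ ⟨A⟩`. -/
def realWaveletPoint (A P : GL (Fin d) ℝ) (j : ℤ) (v : Fin d → ℝ) : WaveletGroup A :=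
  WaveletGroup.mk (((A ^ j * P : GL (Fin d) ℝ) : Matrix (Fin d) (Fin d) ℝ) *ᵥ v)
    ⟨A ^ j, Subgroup.zpow_mem_zpowers A j⟩

theorem GL_mulVec_injective (M : GL (Fin d) ℝ) :
    Function.Injective fun v : Fin d → ℝ => (M : Matrix (Fin d) (Fin d) ℝ) *ᵥ v := by
  intro v w h
  have h' := congrArg (fun z => ((M⁻¹ : GL (Fin d) ℝ) : Matrix (Fin d) (Fin d) ℝ) *ᵥ z) h
  simpa [Matrix.mulVec_mulVec, ← Units.val_mul] using h'

theorem zpow_eq_of_dil_eq {A P : GL (Fin d) ℝ} {j j' : ℤ} {v v' : Fin d → ℝ}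
    (h : (realWaveletPoint A P j v).dil = (realWaveletPoint A P j' v').dil) : A ^ j = A ^ j' :=
  congrArg Subtype.val h

theorem isSeparatedSet_realWaveletPoint {A : GL (Fin d) ℝ}
    (hA : Function.Injective fun j : ℤ => A ^ j) (P : GL (Fin d) ℝ)
    {s : Set (ℤ × (Fin d → ℤ))} {v : ℤ × (Fin d → ℤ) → Fin d → ℝ}
    (hs : ∀ j k k', (j, k) ∈ s → (j, k') ∈ s → ‖v (j, k) - v (j, k')‖ < 1 → k = k') :
    IsSeparatedSet ((fun p => realWaveletPoint A P p.1 (v p)) '' s) := by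
  -- Two points in one left translate of this set share their dilation Aʲ, and in the coordinates of
  -- Aʲ P they differ by less than 1/2 + 1/2.
  refine ⟨{g | ‖((P⁻¹ : GL (Fin d) ℝ) : Matrix (Fin d) (Fin d) ℝ) *ᵥ g.trans‖ < 1 / 2} ∩
    WaveletGroup.dil ⁻¹' {1}, ?_, ⟨1, ?_, rfl⟩, ?_⟩
  · refine IsOpen.inter (isOpen_lt ?_ continuous_const) (WaveletGroup.isOpen_dil_preimage _)
    exact ((continuous_mulVec_left _).comp WaveletGroup.continuous_trans).norm
  · have h : (1 : WaveletGroup A).trans = 0 := rfl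
    simp [h]
  · rintro g _ ⟨⟨⟨j, k⟩, hp, rfl⟩, w, ⟨hw1, hw2⟩, hw⟩ _ ⟨⟨⟨j', k'⟩, hp', rfl⟩, w', ⟨hw1', hw2'⟩, hw'⟩
    simp only [smul_eq_mul] at hw hw'
    have hd : (realWaveletPoint A P j (v (j, k))).dil = g.dil := by
      rw [← hw, WaveletGroup.dil_mul, hw2, mul_one]
    have hd' : (realWaveletPoint A P j' (v (j', k'))).dil = g.dil := by
      rw [← hw', WaveletGroup.dil_mul, hw2', mul_one]
    obtain rfl : j = j' := hA (zpow_eq_of_dil_eq (hd.trans hd'.symm))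
    have hg : (g.dil : GL (Fin d) ℝ) = A ^ j := congrArg Subtype.val hd.symm
    have ht := congrArg WaveletGroup.trans hw
    have ht' := congrArg WaveletGroup.trans hw'
    rw [WaveletGroup.trans_mul, hg] at ht ht'
    have hvw : v (j, k) - v (j, k') =
        ((P⁻¹ : GL (Fin d) ℝ) : Matrix (Fin d) (Fin d) ℝ) *ᵥ w.trans
          - ((P⁻¹ : GL (Fin d) ℝ) : Matrix (Fin d) (Fin d) ℝ) *ᵥ w'.trans := by
      apply GL_mulVec_injective (A ^ j * P)
      have e : A ^ j * P * P⁻¹ = A ^ j := mul_inv_cancel_right _ _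
      simp only [Matrix.mulVec_sub, Matrix.mulVec_mulVec, ← Units.val_mul, e]
      have e1 : (realWaveletPoint A P j (v (j, k))).trans
        = ((A ^ j * P : GL (Fin d) ℝ) : Matrix (Fin d) (Fin d) ℝ) *ᵥ v (j, k) := rfl
      have e2 : (realWaveletPoint A P j (v (j, k'))).trans
        = ((A ^ j * P : GL (Fin d) ℝ) : Matrix (Fin d) (Fin d) ℝ) *ᵥ v (j, k') := rfl
      rw [← e1, ← e2, ← ht, ← ht']
      abel
    have hlt : ‖v (j, k) - v (j, k')‖ < 1 := by
      rw [hvw]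
      refine (norm_sub_le _ _).trans_lt ?_
      simp only [Set.mem_ofPred_eq] at hw1 hw1'
      linarith
    rw [hs j k k' hp hp' hlt]

/-- Split k by parity into 2^d classes. If perturbed points of one class at one scale are closer
than 1, each kᵢ - k'ᵢ is even and less than 2 in absolute value, hence zero. -/
theorem isRelativelySeparated_realWaveletPoint {A : GL (Fin d) ℝ}
    (hA : Function.Injective fun j : ℤ => A ^ j) (P : GL (Fin d) ℝ)
    {u : ℤ × (Fin d → ℤ) → Fin d → ℝ} (hu : ∀ p i, u p i ∈ Set.Ico (0 : ℝ) 1) :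
    IsRelativelySeparated (Set.range fun p : ℤ × (Fin d → ℤ) =>
      realWaveletPoint A P p.1 ((fun i => (p.2 i : ℝ)) + u p)) := by
  refine ⟨Set.range fun c : Fin d → ZMod 2 => (fun p : ℤ × (Fin d → ℤ) =>
      realWaveletPoint A P p.1 ((fun i => (p.2 i : ℝ)) + u p)) ''
      {p | ∀ i, ((p.2 i : ℤ) : ZMod 2) = c i}, Set.finite_range _, ?_, ?_⟩
  · rintro _ ⟨c, rfl⟩
    refine isSeparatedSet_realWaveletPoint hA P fun j k k' hk hk' hlt => ?_
    funext i
    have h1 : |((k i : ℝ) + u (j, k) i) - ((k' i : ℝ) + u (j, k') i)| < 1 :=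
      (norm_le_pi_norm (((fun i => (k i : ℝ)) + u (j, k)) - ((fun i => (k' i : ℝ)) + u (j, k')))
        i).trans_lt hlt
    obtain ⟨m, hm⟩ : (2 : ℤ) ∣ k i - k' i := by
      have : ((k i - k' i : ℤ) : ZMod 2) = 0 := by
        rw [Int.cast_sub, hk i, hk' i, sub_self]
      exact_mod_cast (ZMod.intCast_zmod_eq_zero_iff_dvd _ 2).1 this
    rw [abs_lt] at h1
    have h2 := hu (j, k) i
    have h3 := hu (j, k') i
    have h4 : (k i : ℝ) - k' i < 2 := by linarith [h2.1, h3.2]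
    have h5 : -2 < (k i : ℝ) - k' i := by linarith [h2.2, h3.1]
    have h6 : k i - k' i < 2 := by exact_mod_cast h4
    have h7 : -2 < k i - k' i := by exact_mod_cast h5
    omega
  · ext g
    simp only [Set.mem_range, Set.sUnion_range, Set.mem_iUnion, Set.mem_image, Set.mem_ofPred_eq]
    constructor
    · rintro ⟨p, rfl⟩
      exact ⟨fun i => ((p.2 i : ℤ) : ZMod 2), p, fun _ => rfl, rfl⟩
    · rintro ⟨c, p, -, rfl⟩
      exact ⟨p, rfl⟩

theorem realWaveletPoint_injective {A : GL (Fin d) ℝ}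
    (hA : Function.Injective fun j : ℤ => A ^ j) (P : GL (Fin d) ℝ)
    {u : ℤ × (Fin d → ℤ) → Fin d → ℝ} (hu : ∀ p i, u p i ∈ Set.Ico (0 : ℝ) 1) :
    Function.Injective fun p : ℤ × (Fin d → ℤ) =>
      realWaveletPoint A P p.1 ((fun i => (p.2 i : ℝ)) + u p) := by
  rintro ⟨j, k⟩ ⟨j', k'⟩ h
  obtain rfl : j = j' := hA (zpow_eq_of_dil_eq (congrArg WaveletGroup.dil h))
  have hv := GL_mulVec_injective (A ^ j * P) (congrArg WaveletGroup.trans h)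
  refine Prod.ext rfl (funext fun i => ?_)
  have h1 : ⌊(k i : ℝ) + u (j, k) i⌋ = ⌊(k' i : ℝ) + u (j, k') i⌋ := congrArg Int.floor (congrFun hv i)
  rw [Int.floor_intCast_add, Int.floor_intCast_add,
    Int.floor_eq_zero_iff.2 (hu _ i), Int.floor_eq_zero_iff.2 (hu _ i)] at h1
  simpa using h1

theorem tsum_coeffSq_ne_top_of_mem_besselVectors {A : GL (Fin d) ℝ}
    (hA : Function.Injective fun j : ℤ => A ^ j) (P : GL (Fin d) ℝ) {ψ : L2 d}
    (hψ : ψ ∈ besselVectors A) (f : L2 d)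
    {u : ℤ × (Fin d → ℤ) → Fin d → ℝ} (hu : ∀ p i, u p i ∈ Set.Ico (0 : ℝ) 1) :
    ∑' p : ℤ × (Fin d → ℤ), coeffSq f ψ (A ^ p.1)
      (((A ^ p.1 * P : GL (Fin d) ℝ) : Matrix (Fin d) (Fin d) ℝ) *ᵥ
        ((fun i => (p.2 i : ℝ)) + u p)) ≠ ∞ := by
  obtain ⟨C, hC⟩ := hψ _ (isRelativelySeparated_realWaveletPoint hA P hu)
  have hs := (hC f).1.comp_injective (i := Set.rangeFactorization _)
    (Set.rangeFactorization_injective.2 (realWaveletPoint_injective hA P hu))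
  have h := hs.tsum_ofReal_ne_top
  simp_rw [coeffSq, enorm_sq_eq_ofReal]
  exact h

theorem coeffSq_le (f ψ : L2 d) (M : GL (Fin d) ℝ) (x : Fin d → ℝ) :
    coeffSq f ψ M x ≤ (‖ψ‖ₑ * ‖f‖ₑ) ^ 2 := by
  unfold coeffSq
  gcongr
  rw [← enorm_affineOp x M ψ, ← ofReal_norm, ← ofReal_norm, ← ofReal_norm,
    ← ENNReal.ofReal_mul (norm_nonneg _)]
  exact ENNReal.ofReal_le_ofReal (norm_inner_le_norm _ _)

/-- The largest value of `|⟨f, π(Aʲ P (k + u), Aʲ) ψ⟩|²` over the unit cell `u ∈ [0, 1)ᵈ`. -/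
def cellSup (A P : GL (Fin d) ℝ) (f ψ : L2 d) (p : ℤ × (Fin d → ℤ)) : ℝ≥0∞ :=
  ⨆ u : {u : Fin d → ℝ // ∀ i, u i ∈ Set.Ico (0 : ℝ) 1}, coeffSq f ψ (A ^ p.1)
    (((A ^ p.1 * P : GL (Fin d) ℝ) : Matrix (Fin d) (Fin d) ℝ) *ᵥ
      ((fun i => (p.2 i : ℝ)) + u.1))

/-- The supremum in a cell need not be attained, so each cell contributes a point reaching half of
it. The Bessel property for this one set of points, which depends on f, bounds the whole sum. -/
theorem tsum_cellSup_ne_top {A : GL (Fin d) ℝ}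
    (hA : Function.Injective fun j : ℤ => A ^ j) (P : GL (Fin d) ℝ) {ψ : L2 d}
    (hψ : ψ ∈ besselVectors A) (f : L2 d) :
    ∑' p, cellSup A P f ψ p ≠ ∞ := by
  have hex : ∀ p, ∃ u : {u : Fin d → ℝ // ∀ i, u i ∈ Set.Ico (0 : ℝ) 1},
      cellSup A P f ψ p ≤ 2 * coeffSq f ψ (A ^ p.1)
        (((A ^ p.1 * P : GL (Fin d) ℝ) : Matrix (Fin d) (Fin d) ℝ) *ᵥ
          ((fun i => (p.2 i : ℝ)) + u.1)) := by
    intro p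
    by_cases h0 : cellSup A P f ψ p = 0
    · exact ⟨⟨0, fun i => by simp⟩, by simp [h0]⟩
    have ht : cellSup A P f ψ p ≠ ∞ := by
      refine ne_top_of_le_ne_top (b := (‖ψ‖ₑ * ‖f‖ₑ) ^ 2) ?_ (iSup_le fun u => coeffSq_le _ _ _ _)
      exact ENNReal.pow_ne_top (ENNReal.mul_ne_top enorm_ne_top enorm_ne_top)
    obtain ⟨u, hu⟩ := lt_iSup_iff.1 (ENNReal.half_lt_self h0 ht)
    refine ⟨u, ?_⟩
    rw [← ENNReal.mul_div_cancel (a := 2) (b := cellSup A P f ψ p) two_ne_zero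
      ENNReal.ofNat_ne_top]
    exact mul_le_mul_right hu.le 2
  choose u hu using hex
  refine ne_top_of_le_ne_top ?_ (ENNReal.tsum_le_tsum hu)
  rw [ENNReal.tsum_mul_left]
  exact ENNReal.mul_ne_top ENNReal.ofNat_ne_top
    (tsum_coeffSq_ne_top_of_mem_besselVectors hA P hψ f fun p => (u p).2)

theorem scaleSum_le_tsum_cellSup (A P : GL (Fin d) ℝ) (f ψ : L2 d) (j : ℤ) (x : Fin d → ℝ) :
    scaleSum A P f ψ j x ≤ ∑' k, cellSup A P f ψ (j, k) := by
  obtain ⟨v, rfl⟩ : ∃ v : Fin d → ℝ,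
      ((A ^ j * P : GL (Fin d) ℝ) : Matrix (Fin d) (Fin d) ℝ) *ᵥ v = x :=
    ⟨(((A ^ j * P)⁻¹ : GL (Fin d) ℝ) : Matrix (Fin d) (Fin d) ℝ) *ᵥ x, by
      rw [Matrix.mulVec_mulVec, ← Units.val_mul, mul_inv_cancel, Units.val_one,
        Matrix.one_mulVec]⟩
  -- The integer part of the shift is absorbed by reindexing k; the fractional part stays in the
  -- unit cell.
  rw [← (Equiv.addRight fun i => ⌊v i⌋).tsum_eq]
  refine ENNReal.tsum_le_tsum fun k => ?_
  refine le_trans (le_of_eq ?_) (le_iSup _ ⟨fun i => Int.fract (v i), fun i =>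
    ⟨Int.fract_nonneg _, Int.fract_lt_one _⟩⟩)
  rw [← Matrix.mulVec_add]
  congr 2
  funext i
  simp only [Pi.add_apply, Equiv.coe_addRight, Int.cast_add]
  linarith [Int.floor_add_fract (v i)]

end RelativelySeparated

/-! ### Scalar dilations and the contradiction -/

/-- The scalar matrix `c` as an element of `GL(d, ℝ)`. -/
def scalarGL (d : ℕ) (c : ℝˣ) : GL (Fin d) ℝ :=
  Units.map (Matrix.scalar (Fin d)).toMonoidHom c

theorem det_scalarGL (c : ℝˣ) :
    (scalarGL d c : Matrix (Fin d) (Fin d) ℝ).det = (c : ℝ) ^ d := by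
  simp [scalarGL, Matrix.scalar_apply]

theorem commute_scalarGL (A : GL (Fin d) ℝ) (c : ℝˣ) : Commute A (scalarGL d c) :=
  Units.ext (Matrix.scalar_commute (c : ℝ) (fun r => mul_comm _ r)
    (A : Matrix (Fin d) (Fin d) ℝ)).symm.eq

end

theorem mainTheorem2 {d : ℕ} (A P : GL (Fin d) ℝ)
    (h : ∃ ψ ∈ besselVectors A,
      IsParsevalFrame (fun jk : ℤ × (Fin d → ℤ) =>
        quasiRegular A (waveletPoint A P jk.1 jk.2) ψ)) :
    |(A : Matrix (Fin d) (Fin d) ℝ).det| ≠ 1 := by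
  intro hA
  obtain ⟨ψ, hψ, hframe⟩ := h
  have hsum := tsum_scaleSum_of_isParsevalFrame hframe
  have hinj := zpow_injective_of_tsum_scaleSum hsum
  have hd : d ≠ 0 := by
    rintro rfl
    exact zero_ne_one (hinj (Subsingleton.elim (A ^ (0 : ℤ)) (A ^ (1 : ℤ))))
  have hψ0 : ‖ψ‖ₑ ^ 2 ≠ 0 := by simpa using ne_zero_of_tsum_scaleSum hsum
  have hψt : ‖ψ‖ₑ ^ 2 ≠ ⊤ := ENNReal.pow_ne_top enorm_ne_top
  -- Any scalar c > 6 would do: c^d > 2 · 3^d is needed for every d ≥ 1, and d = 1 is the tightest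
  -- case.
  set S := scalarGL d (Units.mk0 8 (by norm_num))
  have hS : ENNReal.ofReal |(S : Matrix (Fin d) (Fin d) ℝ).det| = 8 ^ d := by
    rw [det_scalarGL, Units.val_mk0, abs_of_pos (by positivity),
      ENNReal.ofReal_pow (by norm_num)]
    simp
  set κ := ENNReal.ofReal |(P : Matrix (Fin d) (Fin d) ℝ).det|⁻¹
  set g := affineOp 0 S⁻¹ ψ
  have hg : affineOp 0 S g = ψ := by
    rw [affineOp_affineOp, Matrix.mulVec_zero, add_zero, mul_inv_cancel, affineOp_zero_one]
  have hlower : 2 ^ d * ‖ψ‖ₑ ^ 2 ≤ 2 * 3 ^ d * (κ * totalCorrelation A g ψ) := by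
    have ha := tsum_cellSup_ne_top hinj P hψ g
    rw [ENNReal.tsum_prod'] at ha
    have h := le_totalCorrelation hA g ψ (hsum g) ha (scaleSum_le_tsum_cellSup A P g ψ)
    rwa [enorm_affineOp] at h
  have hupper : κ * totalCorrelation A (affineOp 0 S ψ) ψ ≤ 2 ^ d * ‖ψ‖ₑ ^ 2 := by
    have h := totalCorrelation_le hA (affineOp 0 S ψ) ψ (hsum _)
    rwa [enorm_affineOp] at h
  -- Swap the arguments, write ψ = S g, and pull S out of both slots.
  have hscale : totalCorrelation A (affineOp 0 S ψ) ψ = 8 ^ d * totalCorrelation A g ψ := by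
    rw [totalCorrelation_swap hA, ← hS,
      ← totalCorrelation_affineOp_of_commute g ψ (commute_scalarGL A _), hg]
  have hmul : (2 ^ d * ‖ψ‖ₑ ^ 2) * 8 ^ d ≤ (2 ^ d * ‖ψ‖ₑ ^ 2) * (2 * 3 ^ d) :=
    calc (2 ^ d * ‖ψ‖ₑ ^ 2) * 8 ^ d
        ≤ 2 * 3 ^ d * (κ * totalCorrelation A g ψ) * 8 ^ d := by gcongr
      _ = 2 * 3 ^ d * (κ * totalCorrelation A (affineOp 0 S ψ) ψ) := by
          rw [hscale]
          ring
      _ ≤ 2 * 3 ^ d * (2 ^ d * ‖ψ‖ₑ ^ 2) := by gcongr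
      _ = _ := mul_comm _ _
  have hcancel := (ENNReal.mul_le_mul_iff_right (mul_ne_zero (pow_ne_zero _ two_ne_zero) hψ0)
    (ENNReal.mul_ne_top (ENNReal.pow_ne_top ENNReal.ofNat_ne_top) hψt)).1 hmul
  have hnat : 8 ^ d ≤ 2 * 3 ^ d := by exact_mod_cast hcancel
  obtain ⟨e, rfl⟩ := Nat.exists_eq_succ_of_ne_zero hd
  have hpow : 3 ^ e ≤ 8 ^ e := Nat.pow_le_pow_left (by norm_num) e
  have hpos : 0 < 3 ^ e := by positivity
  rw [pow_succ, pow_succ] at hnat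
  omega
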